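/- Let $d\ge 2$. A \emph{$d$-ary tree} is a rooted tree, possibly empty, whose internal vertices all have at least two and at most $d$ children; $\|T\|$ denotes the number of leaves of $T$. A set $S$ of leaves of $T$ induces a $d$-ary tree: take the smallest subtree containing $S$ and suppress all vertices with a single child. Let $c(D,T)$ be the number of sets of $\|D\|$ leaves of $T$ that induce a tree isomorphic to $D$ (as a rooted tree), let $\gamma(D,T)=c(D,T)/\binom{\|T\|}{\|D\|}$, and let $$I_d(D)=\limsup_{\substack{\|T\|\to\infty\\ T\ d\text{-ary tree}}}\gamma(D,T),\qquad \eta_d(D)=\lim_{n\to\infty}\gamma(D,H_n^d),$$ where $H_0^d$ is a single leaf and, for $n>0$ with $n-1=ds+b$, $0\le b<d$, the tree $H_n^d$ consists of a root whose $d$ branches are $d-b$ copies of $H_s^d$ and $b$ copies of $H_{s+1}^d$. Let $D$ be a $d$-ary tree with branches $D_1,\dots,D_d$ (the components that remain when the root is removed, padded with empty trees). Let $M(D)$ be a complete set of representatives of the permutations of $\{1,\dots,d\}$ modulo the equivalence relation $\pi\sim\pi'$ iff $D_{\pi(j)}\cong D_{\pi'(j)}$ for all $j$, and let $$Z_D(x_1,\dots,x_d)=\frac{1}{1-\sum_{i=1}^d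 x_i^{\|D\|}}\sum_{\pi\in M(D)}\ \prod_{j=1}^d x_j^{\|D_{\pi(j)}\|}$$ (with the convention $1/0=0$, which matters only if $D$ is a single vertex). Suppose that $I_d(D_i)=\eta_d(D_i)$ for all $i$, and that the supremum of $Z_D(x_1,\dots,x_d)$ under the conditions $0\le x_i<1$ and $x_1+\cdots+x_d=1$ is attained at $x_1=\cdots=x_d=\frac1d$, i.e. $$\sup_{\substack{0\le x_1,\dots,x_d<1\\ x_1+\cdots+x_d=1}}Z_D(x_1,\dots,x_d)=Z_D\Big(\frac1d,\dots,\frac1d\Big).$$ Then $Z_D(\frac1d,\dots,\frac1d)=\frac{|M(D)|}{d^{\|D\|}-d}$, the limit defining $\eta_d(D)$ exists, and $I_d(D)=\eta_d(D)$. -/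

import Mathlib

open Filter Topology

namespace Inducibility

/-- Trees whose vertices have `d` child slots, some of which may be empty (`empty` is the tree with
no vertices). The order of the slots is irrelevant: trees are compared by `Iso`. -/
inductive PTree (d : ℕ) : Type
  | empty : PTree d
  | leaf : PTree d
  | node (c : Fin d → PTree d) : PTree d

namespace PTree

variable {d : ℕ}

/-- `T` is a (possibly empty) `d`-ary tree: every internal vertex has at least two (and, by
construction, at most `d`) children. -/
def IsDAry : PTree d → Prop
  | empty => True
  | leaf => True
  | node c => (∃ i j, i ≠ j ∧ c i ≠ empty ∧ c j ≠ empty) ∧ ∀ i, (c i).IsDAry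

/-- The number of leaves `‖T‖`. -/
def numLeaves : PTree d → ℕ
  | empty => 0
  | leaf => 1
  | node c => ∑ i, (c i).numLeaves

/-- The type of leaves of `T`. -/
def Leaf : PTree d → Type
  | empty => Empty
  | leaf => Unit
  | node c => Σ i, (c i).Leaf

instance finite_leaf : ∀ T : PTree d, Finite T.Leaf
  | empty => inferInstanceAs (Finite Empty)
  | leaf => inferInstanceAs (Finite Unit)
  | node c =>
    have : ∀ i, Finite (c i).Leaf := fun i => finite_leaf (c i)
    inferInstanceAs (Finite (Σ i, (c i).Leaf))

theorem card_leaf : ∀ T : PTree d, Nat.card T.Leaf = T.numLeaves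
  | empty => (Nat.card_of_isEmpty : Nat.card Empty = 0)
  | leaf => (Nat.card_unique : Nat.card Unit = 1)
  | node c => by
    have h : Nat.card (Σ i, (c i).Leaf) = ∑ i, Nat.card (c i).Leaf := Nat.card_sigma
    exact h.trans (Finset.sum_congr rfl fun i _ => card_leaf (c i))

/-- Isomorphism of rooted trees. -/
inductive Iso : PTree d → PTree d → Prop
  | empty : Iso empty empty
  | leaf : Iso leaf leaf
  | node {c c' : Fin d → PTree d} (σ : Equiv.Perm (Fin d)) (h : ∀ i, Iso (c i) (c' (σ i))) :
      Iso (node c) (node c')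

theorem Iso.refl : ∀ T : PTree d, Iso T T
  | .empty => .empty
  | .leaf => .leaf
  | .node c => .node 1 fun i => Iso.refl (c i)

theorem Iso.symm {S T : PTree d} (h : Iso S T) : Iso T S := by
  induction h with
  | empty => exact .empty
  | leaf => exact .leaf
  | node σ _ ih => exact .node σ.symm fun i => by simpa using ih (σ.symm i)

theorem Iso.trans {S T U : PTree d} (h : Iso S T) (h' : Iso T U) : Iso S U := by
  induction h generalizing U with
  | empty => exact h'
  | leaf => exact h'
  | node σ _ ih =>
    cases h' with
    | node τ h' => exact .node (σ.trans τ) fun i => ih i (h' (σ i))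

open Classical in
/-- Connect the nonempty trees among the `c i` to a new root, which is suppressed if it has only
one child; the result is empty if all the `c i` are empty. -/
noncomputable def joinRoot (c : Fin d → PTree d) : PTree d :=
  if h : ∃! i, c i ≠ empty then c h.choose
  else if ∀ i, c i = empty then empty
  else node c

/-- The subtree of `T` induced by a set `S` of its leaves. -/
noncomputable def induced : (T : PTree d) → Set T.Leaf → PTree d
  | empty, _ => empty
  | leaf, S =>
    open Classical in if S = ∅ then empty else leaf
  | node c, S => joinRoot fun i => (c i).induced {x | (⟨i, x⟩ : Σ i, (c i).Leaf) ∈ S}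

/-- `c(D, T)`: the number of sets of `‖D‖` leaves of `T` that induce a tree isomorphic to `D`. -/
noncomputable def copies (D T : PTree d) : ℕ :=
  Set.ncard {S : Set T.Leaf | S.ncard = D.numLeaves ∧ Iso (T.induced S) D}

/-- The density `γ(D, T)`. -/
noncomputable def density (D T : PTree d) : ℝ :=
  (copies D T : ℝ) / (T.numLeaves.choose D.numLeaves : ℝ)

/-- The inducibility `I_d(D)`: the limit superior of `γ(D, T)` over all `d`-ary trees `T`, as
`‖T‖ → ∞`. -/
noncomputable def inducibility (D : PTree d) : ℝ :=
  limsup (fun T : {T : PTree d // T.IsDAry} => density D T.1)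
    (comap (fun T : {T : PTree d // T.IsDAry} => T.1.numLeaves) atTop)

/-- The strictly `d`-ary tree `H_n^d` whose leaves are distributed as evenly as possible: `H_0^d`
is a leaf, and if `n - 1 = d * s + b` with `0 ≤ b < d`, then the branches of `H_n^d` are `d - b`
copies of `H_s^d` and `b` copies of `H_{s+1}^d`. -/
def H (d : ℕ) : ℕ → PTree d
  | 0 => leaf
  | m + 1 => node fun i =>
      if (i : ℕ) < d - m % d then H d (m / d) else H d (m / d + 1)
decreasing_by
  · exact Nat.lt_succ_of_le (Nat.div_le_self _ _)
  · have h1 := Nat.div_add_mod m d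
    have _ := i.2
    have h3 : m / d ≤ d * (m / d) := Nat.le_mul_of_pos_left _ (by omega)
    omega

/-- `η_d(D) = lim_{n → ∞} γ(D, H_n^d)`. -/
noncomputable def eta (D : PTree d) : ℝ :=
  limUnder atTop fun n : ℕ => density D (H d n)

/-- The branches `D_1, …, D_d` of `D`, some of them possibly empty. -/
def branch : PTree d → Fin d → PTree d
  | empty, _ => empty
  | leaf, _ => empty
  | node c, i => c i

/-- The equivalence relation `∼_D` on permutations. -/
def permSetoid (D : PTree d) : Setoid (Equiv.Perm (Fin d)) where
  r π π' := ∀ j, Iso (D.branch (π j)) (D.branch (π' j))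
  iseqv :=
    { refl := fun _ _ => Iso.refl _
      symm := fun h j => (h j).symm
      trans := fun h h' j => (h j).trans (h' j) }

open Classical in
/-- `M(D)`: a complete set of representatives of the classes of `∼_D`. -/
noncomputable def M (D : PTree d) : Finset (Equiv.Perm (Fin d)) :=
  Finset.univ.image fun π => (Quotient.mk D.permSetoid π).out

/-- The function `Z_D`. -/
noncomputable def Z (D : PTree d) (x : Fin d → ℝ) : ℝ :=
  1 / (1 - ∑ i, x i ^ D.numLeaves) *
    ∑ π ∈ D.M, ∏ j, x j ^ (D.branch (π j)).numLeaves

end PTree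

/-- The points with `0 ≤ x_i < 1` for all `i` and `x_1 + ⋯ + x_d = 1`. -/
def simplexDomain (d : ℕ) : Set (Fin d → ℝ) :=
  {x | (∀ i, 0 ≤ x i ∧ x i < 1) ∧ ∑ i, x i = 1}

end Inducibility

/-! Write `k = ‖D‖`. A set of leaves of a tree with branches `T_j` that induces `D` either lies
inside one branch or has its meeting point at the root. In the second case the branches of `D` are
distributed over the `T_j` by a unique class in `M(D)`. This gives the exact recursion
`copies_node_node`, on which everything rests.

On the even trees, dividing the recursion by `‖H_n‖ ^ k` gives a linear recursion whose weights sum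
to about `d ^ (1 - k) < 1`. It is therefore asymptotically a contraction, and the normalized counts
converge to its fixed point `evenCoeff D` (`tendsto_copies_H`). Hence `η(D) = k! * evenCoeff D`.

For the upper bound, blow-ups turn the asymptotic quantity `I_d(E)` into an error-free bound `c(E,
T) ≤ I_d(E) / ‖E‖! * ‖T‖ ^ ‖E‖` for every nonempty `T` (`copies_le_inducibility_mul`). Applied to
the branches of `D`, where `I_d = η_d`, it bounds the copies that meet at the root by a multiple of
the numerator of `Z_D` at the leaf proportions. Since `Z_D` is largest at the uniform point, `c(D,
T) ≤ evenCoeff D * ‖T‖ ^ k` follows by induction on `T` (`copies_node_le`). The even trees attain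
this asymptotically. -/

namespace Inducibility

namespace PTree

variable {d : ℕ}

/-! ### Leaf counts and induced subtrees -/

theorem Iso.numLeaves_eq {S T : PTree d} (h : Iso S T) : S.numLeaves = T.numLeaves := by
  induction h with
  | empty => rfl
  | leaf => rfl
  | node σ _ ih =>
    exact (Finset.sum_congr rfl fun i _ => ih i).trans (Equiv.sum_comp σ fun i => numLeaves _)

theorem Iso.eq_empty_iff {S T : PTree d} (h : Iso S T) :
    S = PTree.empty ↔ T = PTree.empty := by
  cases h <;> simp

theorem iso_empty_iff {T : PTree d} : Iso T empty ↔ T = empty :=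
  ⟨fun h => h.eq_empty_iff.2 rfl, fun h => h ▸ Iso.empty⟩

theorem joinRoot_of_unique {c : Fin d → PTree d} {i : Fin d} (hi : c i ≠ empty)
    (h : ∀ j, j ≠ i → c j = empty) : joinRoot c = c i := by
  have hu : ∃! i, c i ≠ empty := ⟨i, hi, fun j hj => by_contra fun hji => hj (h j hji)⟩
  have : hu.choose = i := by_contra fun hji => hu.choose_spec.1 (h _ hji)
  rw [joinRoot, dif_pos hu, this]

theorem joinRoot_of_forall {c : Fin d → PTree d} (h : ∀ j, c j = empty) :
    joinRoot c = empty := by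
  have hu : ¬ ∃! i, c i ≠ empty := fun ⟨i, hi, _⟩ => hi (h i)
  rw [joinRoot, dif_neg hu, if_pos h]

theorem joinRoot_of_two {c : Fin d → PTree d} {i j : Fin d} (hij : i ≠ j) (hi : c i ≠ empty)
    (hj : c j ≠ empty) : joinRoot c = node c := by
  have hu : ¬ ∃! i, c i ≠ empty := fun h => hij (h.unique hi hj)
  rw [joinRoot, dif_neg hu, if_neg fun h => hi (h i)]

/-- The root of a joined tree is suppressed, absent, or a genuine branching vertex. -/
theorem joinRoot_trichotomy (c : Fin d → PTree d) :
    (∃ i, c i ≠ empty ∧ ∀ j, j ≠ i → c j = empty) ∨ (∀ j, c j = empty) ∨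
      ∃ i j, i ≠ j ∧ c i ≠ empty ∧ c j ≠ empty := by
  by_cases h : ∀ j, c j = empty
  · exact .inr (.inl h)
  · push Not at h
    obtain ⟨i, hi⟩ := h
    by_cases h' : ∀ j, j ≠ i → c j = empty
    · exact .inl ⟨i, hi, h'⟩
    · push Not at h'
      obtain ⟨j, hji, hj⟩ := h'
      exact .inr (.inr ⟨i, j, hji.symm, hi, hj⟩)

theorem numLeaves_joinRoot (c : Fin d → PTree d) :
    (joinRoot c).numLeaves = ∑ i, (c i).numLeaves := by
  rcases joinRoot_trichotomy c with ⟨i, hi, h⟩ | h | ⟨i, j, hij, hi, hj⟩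
  · rw [joinRoot_of_unique hi h, Finset.sum_eq_single i]
    · intro j _ hj
      rw [h j hj]; rfl
    · simp
  · rw [joinRoot_of_forall h]
    simp [h, numLeaves]
  · rw [joinRoot_of_two hij hi hj]; rfl

theorem numLeaves_induced : ∀ (T : PTree d) (S : Set T.Leaf), (T.induced S).numLeaves = S.ncard
  | empty, S => by
    have : S = ∅ := Set.eq_empty_of_forall_notMem fun x => nomatch (show Empty from x)
    subst this
    simp [induced, numLeaves]
  | leaf, S => by
    have hu : ∀ x y : (leaf : PTree d).Leaf, x = y := fun (x y : Unit) => rfl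
    by_cases h : S = ∅
    · subst h; simp [induced, numLeaves]
    · obtain ⟨x, hx⟩ := Set.nonempty_iff_ne_empty.2 h
      have : S = {x} := Set.eq_singleton_iff_unique_mem.2 ⟨hx, fun y _ => hu y x⟩
      rw [induced, if_neg h, this, Set.ncard_singleton]; rfl
  | node c, S => by
    rw [induced, numLeaves_joinRoot]
    simp only [numLeaves_induced]
    have h : Nat.card (Σ i, {x : (c i).Leaf | (⟨i, x⟩ : Σ i, (c i).Leaf) ∈ S}) =
        ∑ i, Nat.card {x : (c i).Leaf | (⟨i, x⟩ : Σ i, (c i).Leaf) ∈ S} := Nat.card_sigma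
    refine h.symm.trans (Nat.card_congr ?_)
    exact
      { toFun := fun x => ⟨(⟨x.1, x.2.1⟩ : Σ i, (c i).Leaf), x.2.2⟩
        invFun := fun x => ⟨(show Σ i, (c i).Leaf from x.1).1, (show Σ i, (c i).Leaf from x.1).2, x.2⟩
        left_inv := fun _ => rfl
        right_inv := fun _ => rfl }

theorem numLeaves_eq_zero_iff {T : PTree d} (hT : T.IsDAry) : T.numLeaves = 0 ↔ T = empty := by
  induction T with
  | empty => simp [numLeaves]
  | leaf => simp [numLeaves]
  | node c ih =>
    obtain ⟨⟨i, j, hij, hi, hj⟩, h⟩ := hT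
    simp only [numLeaves, reduceCtorEq, iff_false]
    intro h0
    exact hi ((ih i (h i)).1 (Finset.sum_eq_zero_iff.1 h0 i (Finset.mem_univ i)))

theorem isDAry_joinRoot {c : Fin d → PTree d} (h : ∀ i, (c i).IsDAry) : (joinRoot c).IsDAry := by
  rcases joinRoot_trichotomy c with ⟨i, hi, h'⟩ | h' | ⟨i, j, hij, hi, hj⟩
  · rw [joinRoot_of_unique hi h']; exact h i
  · rw [joinRoot_of_forall h']; trivial
  · rw [joinRoot_of_two hij hi hj]; exact ⟨⟨i, j, hij, hi, hj⟩, h⟩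

theorem isDAry_induced : ∀ (T : PTree d) (S : Set T.Leaf), (T.induced S).IsDAry
  | empty, S => trivial
  | leaf, S => by
    rw [induced]; split_ifs <;> trivial
  | node c, S => by
    rw [induced]
    exact isDAry_joinRoot fun i => isDAry_induced (c i) _

theorem induced_eq_empty_iff (T : PTree d) (S : Set T.Leaf) : T.induced S = empty ↔ S = ∅ := by
  rw [← numLeaves_eq_zero_iff (isDAry_induced T S), numLeaves_induced, Set.ncard_eq_zero]

/-! ### Elementary facts about the number of copies -/

theorem copies_eq_ncard (D T : PTree d) :
    copies D T = Set.ncard {S : Set T.Leaf | Iso (T.induced S) D} := by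
  unfold copies
  congr 1
  ext S
  simp only [Set.mem_ofPred_eq, and_iff_right_iff_imp]
  intro h
  rw [← numLeaves_induced, h.numLeaves_eq]

theorem copies_le_choose (D T : PTree d) : copies D T ≤ T.numLeaves.choose D.numLeaves := by
  classical
  have := Fintype.ofFinite T.Leaf
  calc copies D T ≤ Set.ncard ((fun s : Finset T.Leaf => (s : Set T.Leaf)) ''
        (Finset.powersetCard D.numLeaves (Finset.univ : Finset T.Leaf) : Set (Finset T.Leaf))) := by
        refine Set.ncard_le_ncard (fun S hS => ?_) (Set.toFinite _)
        refine ⟨S.toFinset, ?_, by simp⟩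
        simpa [Finset.mem_powersetCard, Set.ncard_eq_toFinset_card'] using hS.1
    _ ≤ _ := Set.ncard_image_le (Set.toFinite _)
    _ = _ := by
      rw [Set.ncard_coe_finset, Finset.card_powersetCard, Finset.card_univ,
        ← Nat.card_eq_fintype_card, card_leaf]

theorem copies_empty (T : PTree d) : copies empty T = 1 := by
  rw [copies_eq_ncard]
  simp [iso_empty_iff, induced_eq_empty_iff]

theorem iso_leaf_iff {T : PTree d} (hT : T.IsDAry) : Iso T leaf ↔ T.numLeaves = 1 := by
  refine ⟨fun h => h.numLeaves_eq, fun h => ?_⟩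
  cases T with
  | empty => simp [numLeaves] at h
  | leaf => exact .leaf
  | node c =>
    exfalso
    obtain ⟨⟨i, j, hij, hi, hj⟩, hc⟩ := hT
    have hi' := (numLeaves_eq_zero_iff (hc i)).not.2 hi
    have hj' := (numLeaves_eq_zero_iff (hc j)).not.2 hj
    have : (c i).numLeaves + (c j).numLeaves ≤ ∑ l, (c l).numLeaves :=
      (Finset.sum_pair (f := fun l => (c l).numLeaves) hij).symm.trans_le
        (Finset.sum_le_sum_of_subset (Finset.subset_univ _))
    simp only [numLeaves] at h
    omega

theorem copies_leaf (T : PTree d) : copies leaf T = T.numLeaves := by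
  rw [copies_eq_ncard]
  simp only [iso_leaf_iff (isDAry_induced T _), numLeaves_induced]
  have h : {S : Set T.Leaf | S.ncard = 1} = (fun x => {x}) '' Set.univ := by
    ext S
    simp only [Set.mem_ofPred_eq, Set.ncard_eq_one, Set.image_univ, Set.mem_range,
      eq_comm (a := S)]
  rw [h, Set.ncard_image_of_injective _ Set.singleton_injective, Set.ncard_univ, card_leaf]

theorem two_le_numLeaves_node {c : Fin d → PTree d} (h : (node c).IsDAry) :
    2 ≤ (node c).numLeaves := by
  have h0 := (numLeaves_eq_zero_iff h).not.2 (by simp)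
  have h1 : (node c).numLeaves ≠ 1 := fun h1 => by
    cases (iso_leaf_iff h).2 h1
  omega

theorem copies_eq_zero_of_lt {D T : PTree d} (h : T.numLeaves < D.numLeaves) : copies D T = 0 :=
  Nat.le_zero.1 ((copies_le_choose D T).trans (Nat.choose_eq_zero_of_lt h).le)

/-! ### The recursion at the root -/

theorem eq_of_mem_M_of_iso {D : PTree d} {π π' : Equiv.Perm (Fin d)} (hπ : π ∈ D.M)
    (hπ' : π' ∈ D.M) (h : ∀ j, Iso (D.branch (π j)) (D.branch (π' j))) : π = π' := by
  classical
  simp only [M, Finset.mem_image, Finset.mem_univ, true_and] at hπ hπ'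
  obtain ⟨ρ, rfl⟩ := hπ
  obtain ⟨ρ', rfl⟩ := hπ'
  have := Quotient.sound (s := D.permSetoid) h
  simp only [Quotient.out_eq] at this
  rw [this]

theorem exists_mem_M (D : PTree d) (σ : Equiv.Perm (Fin d)) :
    ∃ π ∈ D.M, ∀ j, Iso (D.branch (π j)) (D.branch (σ j)) := by
  classical
  exact ⟨(Quotient.mk D.permSetoid σ).out, Finset.mem_image_of_mem _ (Finset.mem_univ σ),
    Quotient.mk_out (s := D.permSetoid) σ⟩

/-- A joined tree is a copy of `node c` either inside a single branch or with matching roots. -/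
theorem iso_joinRoot_iff {c e : Fin d → PTree d} (hc : (node c).IsDAry) :
    Iso (joinRoot e) (node c) ↔ (∃ i, Iso (e i) (node c) ∧ ∀ j, j ≠ i → e j = empty) ∨
      ∃ π ∈ (node c).M, ∀ j, Iso (e j) (c (π j)) := by
  constructor
  · intro h
    rcases joinRoot_trichotomy e with ⟨i, hi, h'⟩ | h' | ⟨i, j, hij, hi, hj⟩
    · rw [joinRoot_of_unique hi h'] at h
      exact .inl ⟨i, h, h'⟩
    · rw [joinRoot_of_forall h'] at h
      cases h
    · rw [joinRoot_of_two hij hi hj] at h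
      cases h with
      | node σ h =>
        obtain ⟨π, hπ, hπσ⟩ := exists_mem_M (node c) σ
        exact .inr ⟨π, hπ, fun j => (h j).trans (hπσ j).symm⟩
  · rintro (⟨i, h, h'⟩ | ⟨π, -, h⟩)
    · rwa [joinRoot_of_unique (fun h0 => by rw [h0] at h; cases h) h']
    · obtain ⟨⟨i, j, hij, hi, hj⟩, -⟩ := hc
      rw [joinRoot_of_two (i := π.symm i) (j := π.symm j) (by simpa using hij)
        (by rwa [ne_eq, (h _).eq_empty_iff, π.apply_symm_apply])
        (by rwa [ne_eq, (h _).eq_empty_iff, π.apply_symm_apply])]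
      exact .node π h

-- A set of leaves of `node t` is a tuple of leaf sets, one per branch. The tuples inducing `node c`
-- split disjointly into boxes: all leaves in one slot, or one slot assignment for each
-- representative in `M`. Each box contributes a product of counts.
open Classical in
theorem copies_node_node {c : Fin d → PTree d} (hc : (node c).IsDAry) (t : Fin d → PTree d) :
    copies (node c) (node t) = ∑ i, copies (node c) (t i) +
      ∑ π ∈ (node c).M, ∏ j, copies (c (π j)) (t j) := by
  have inst : ∀ i, Fintype (Set (t i).Leaf) := fun i => Fintype.ofFinite _
  have hcop : ∀ (E : PTree d) i, copies E (t i) =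
      (Finset.univ.filter fun S : Set (t i).Leaf => Iso ((t i).induced S) E).card := by
    intro E i
    rw [copies_eq_ncard, Set.ncard_eq_toFinset_card']
    congr 1
    ext S; simp
  let split : Set (node t).Leaf ≃ ∀ i, Set (t i).Leaf :=
    { toFun := fun S i => {x | (⟨i, x⟩ : Σ i, (t i).Leaf) ∈ S}
      invFun := fun P => {x : Σ i, (t i).Leaf | x.2 ∈ P x.1}
      left_inv := fun _ => rfl
      right_inv := fun _ => rfl }
  have hL : copies (node c) (node t) = (Finset.univ.filter fun P : ∀ i, Set (t i).Leaf =>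
      Iso (joinRoot fun i => (t i).induced (P i)) (node c)).card := by
    rw [copies_eq_ncard, ← Set.ncard_coe_finset, ← Set.ncard_image_of_injective _ split.injective]
    congr 1
    ext P
    simp only [Set.mem_image, Set.mem_ofPred_eq, Finset.coe_filter, Finset.mem_univ, true_and]
    constructor
    · rintro ⟨S, hS, rfl⟩
      exact hS
    · intro hP
      exact ⟨split.symm P, hP, split.apply_symm_apply P⟩
  let A : Fin d → Finset (∀ i, Set (t i).Leaf) := fun i => Fintype.piFinset fun j =>
    if j = i then Finset.univ.filter fun S : Set (t j).Leaf => Iso ((t j).induced S) (node c)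
    else {∅}
  let B : Equiv.Perm (Fin d) → Finset (∀ i, Set (t i).Leaf) := fun π => Fintype.piFinset fun j =>
    Finset.univ.filter fun S : Set (t j).Leaf => Iso ((t j).induced S) (c (π j))
  have memA : ∀ i P, P ∈ A i ↔
      Iso ((t i).induced (P i)) (node c) ∧ ∀ j, j ≠ i → (t j).induced (P j) = empty := by
    intro i P
    simp only [A, Fintype.mem_piFinset, induced_eq_empty_iff]
    constructor
    · intro h
      refine ⟨by simpa using h i, fun j hj => by simpa [hj] using h j⟩
    · rintro ⟨h, h'⟩ j
      by_cases hj : j = i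
      · subst hj; simpa using h
      · simpa [hj] using h' j hj
  have memB : ∀ π P, P ∈ B π ↔ ∀ j, Iso ((t j).induced (P j)) (c (π j)) := by
    intro π P
    simp [B, Fintype.mem_piFinset]
  have hsplit : (Finset.univ.filter fun P : ∀ i, Set (t i).Leaf =>
      Iso (joinRoot fun i => (t i).induced (P i)) (node c)) =
        Finset.univ.biUnion A ∪ (node c).M.biUnion B := by
    ext P
    simp only [Finset.mem_filter, Finset.mem_univ, true_and, Finset.mem_union, Finset.mem_biUnion,
      memA, memB, iso_joinRoot_iff hc]
  have hdisj : Disjoint (Finset.univ.biUnion A) ((node c).M.biUnion B) := by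
    rw [Finset.disjoint_left]
    intro P hPA hPB
    simp only [Finset.mem_biUnion, Finset.mem_univ, true_and, memA, memB] at hPA hPB
    obtain ⟨i, -, hi⟩ := hPA
    obtain ⟨π, -, hπ⟩ := hPB
    obtain ⟨⟨a, b, hab, ha, hb⟩, -⟩ := hc
    -- If only slot `i` is occupied, every nonempty branch of `node c` must be placed there, which
    -- is impossible for two of them.
    have key : ∀ a, c a ≠ empty → π.symm a = i := fun a ha => by
      by_contra hai
      have := hπ (π.symm a)
      rw [π.apply_symm_apply] at this
      exact ha (this.eq_empty_iff.1 (hi _ hai))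
    exact hab (π.symm.injective ((key a ha).trans (key b hb).symm))
  have hA : (Finset.univ.biUnion A).card = ∑ i, copies (node c) (t i) := by
    rw [Finset.card_biUnion]
    · refine Finset.sum_congr rfl fun i _ => ?_
      rw [Fintype.card_piFinset, Finset.prod_eq_single i]
      · rw [if_pos rfl, hcop]
      · intro j _ hj; simp [hj]
      · simp
    · intro i _ i' _ hii'
      rw [Function.onFun, Finset.disjoint_left]
      intro P hP hP'
      rw [memA] at hP hP'
      have := hP.1
      rw [hP'.2 i hii'] at this
      cases this
  have hB : ((node c).M.biUnion B).card = ∑ π ∈ (node c).M, ∏ j, copies (c (π j)) (t j) := by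
    rw [Finset.card_biUnion]
    · refine Finset.sum_congr rfl fun π _ => ?_
      rw [Fintype.card_piFinset]
      exact Finset.prod_congr rfl fun j _ => (hcop _ _).symm
    · intro π hπ π' hπ' hne
      rw [Function.onFun, Finset.disjoint_left]
      intro P hP hP'
      rw [memB] at hP hP'
      exact hne (eq_of_mem_M_of_iso hπ hπ' fun j => (hP j).symm.trans (hP' j))
  rw [hL, hsplit, Finset.card_union_of_disjoint hdisj, hA, hB]

end PTree

/-! ### Two limit lemmas -/

/-- A bounded sequence that satisfies an asymptotically contracting recursion, up to an error
tending to zero, tends to zero. -/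
theorem tendsto_zero_of_contraction {ι : Type*} [Fintype ι] {v δ : ℕ → ℝ} {y : ι → ℕ → ℝ}
    {s : ι → ℕ → ℕ} {q C : ℝ} (hv : ∀ n, |v n| ≤ C)
    (hrec : ∀ n, v (n + 1) = ∑ i, y i n * v (s i n) + δ n) (hδ : Tendsto δ atTop (𝓝 0))
    (hs : ∀ i, Tendsto (s i) atTop atTop)
    (hy : Tendsto (fun n => ∑ i, |y i n|) atTop (𝓝 q)) (hq : q < 1) :
    Tendsto v atTop (𝓝 0) := by
  obtain ⟨r, hqr, hr⟩ := exists_between hq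
  have hr0 : 0 ≤ r := (ge_of_tendsto' hy fun n => Finset.sum_nonneg fun _ _ => abs_nonneg _).trans
    hqr.le
  set V := limsup (fun n => |v n|) atTop with hV
  have hbd : IsBoundedUnder (· ≤ ·) atTop fun n => |v n| := isBoundedUnder_of ⟨C, hv⟩
  have hcob : IsCoboundedUnder (· ≤ ·) atTop fun n => |v n| :=
    (isBoundedUnder_of ⟨0, fun n => abs_nonneg _⟩ :
      IsBoundedUnder (· ≥ ·) atTop fun n => |v n|).isCoboundedUnder_le
  have hlt : ∀ B, V < B → ∀ᶠ n in atTop, |v n| < B := fun B hB => eventually_lt_of_limsup_lt hB hbd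
  have hV0 : V ≤ 0 := by
    by_contra! hpos
    -- Small enough that `r * (V + ε) + ε ≤ r * V + 2 * ε < V`, contradicting `h4`.
    set ε := (1 - r) * V / 4 with hε
    have hε0 : 0 < ε := by have := mul_pos (sub_pos.2 hr) hpos; positivity
    have h1 : ∀ᶠ n in atTop, ∀ i, |v (s i n)| < V + ε :=
      eventually_all.2 fun i => (hs i).eventually (hlt (V + ε) (by linarith))
    have h2 : ∀ᶠ n in atTop, |δ n| < ε := by
      simpa using hδ.abs.eventually_lt_const (by simpa using hε0)
    have h3 : ∀ᶠ n in atTop, |v (n + 1)| ≤ r * (V + ε) + ε := by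
      filter_upwards [h1, h2, hy.eventually_lt_const hqr] with n h1 h2 h3
      rw [hrec]
      calc |∑ i, y i n * v (s i n) + δ n| ≤ ∑ i, |y i n| * |v (s i n)| + |δ n| := by
            refine (abs_add_le _ _).trans (add_le_add_left ?_ _)
            refine (Finset.abs_sum_le_sum_abs _ _).trans_eq ?_
            simp [abs_mul]
        _ ≤ (∑ i, |y i n|) * (V + ε) + ε := by
            rw [Finset.sum_mul]
            exact add_le_add (Finset.sum_le_sum fun i _ =>
              mul_le_mul_of_nonneg_left (h1 i).le (abs_nonneg _)) h2.le
        _ ≤ r * (V + ε) + ε := by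
            have : 0 ≤ V + ε := by positivity
            gcongr
    have h4 : V ≤ r * (V + ε) + ε :=
      limsup_le_of_le hcob ((eventually_atTop.1 h3).elim fun N hN => eventually_atTop.2
        ⟨N + 1, fun n hn => by
          obtain ⟨m, rfl⟩ : ∃ m, n = m + 1 := ⟨n - 1, by omega⟩
          exact hN m (by omega)⟩)
    have h5 : r * ε ≤ ε := mul_le_of_le_one_left hε0.le hr.le
    nlinarith [mul_pos (sub_pos.2 hr) hpos]
  rw [tendsto_zero_iff_abs_tendsto_zero]
  refine tendsto_order.2 ⟨fun a ha => Eventually.of_forall fun n => ha.trans_le (abs_nonneg _),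
    fun a ha => hlt a (hV0.trans_lt ha)⟩

theorem tendsto_pow_div_choose (k : ℕ) :
    Tendsto (fun n : ℕ => (n : ℝ) ^ k / (n.choose k : ℝ)) atTop (𝓝 (k.factorial : ℝ)) := by
  have hk : (k.factorial : ℝ) ≠ 0 := by positivity
  have h := (isEquivalent_choose k).symm
  rw [Asymptotics.isEquivalent_iff_tendsto_one] at h
  · have h' := h.const_mul (k.factorial : ℝ)
    rw [mul_one] at h'
    refine h'.congr fun n => ?_
    simp only [Pi.div_apply]
    field_simp
  · filter_upwards [eventually_ge_atTop k] with n hn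
    exact_mod_cast (Nat.choose_pos hn).ne'

namespace PTree

variable {d : ℕ}

/-! ### Densities and blow-ups -/

theorem numLeaves_perm (c : Fin d → PTree d) (π : Equiv.Perm (Fin d)) :
    ∑ j, (c (π j)).numLeaves = (node c).numLeaves :=
  Equiv.sum_comp π fun j => (c j).numLeaves

theorem copies_eq_density_mul (D T : PTree d) :
    (copies D T : ℝ) = density D T * (T.numLeaves.choose D.numLeaves : ℝ) := by
  by_cases h : (T.numLeaves.choose D.numLeaves : ℝ) = 0
  · have h0 : T.numLeaves.choose D.numLeaves = 0 := by exact_mod_cast h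
    rw [h, mul_zero, Nat.le_zero.1 ((copies_le_choose D T).trans h0.le), Nat.cast_zero]
  · rw [density, div_mul_cancel₀ _ h]

theorem density_nonneg (D T : PTree d) : 0 ≤ density D T := by unfold density; positivity

theorem density_le_one (D T : PTree d) : density D T ≤ 1 :=
  div_le_one_of_le₀ (by exact_mod_cast copies_le_choose D T) (by positivity)

/-- Replace every leaf of `T` by a copy of `U`. -/
def blowup : PTree d → PTree d → PTree d
  | empty, _ => empty
  | leaf, U => U
  | node c, U => node fun i => (c i).blowup U

theorem numLeaves_blowup (T U : PTree d) :
    (T.blowup U).numLeaves = T.numLeaves * U.numLeaves := by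
  induction T with
  | empty => simp [blowup, numLeaves]
  | leaf => simp [blowup, numLeaves]
  | node c ih => simp [blowup, numLeaves, ih, Finset.sum_mul]

theorem blowup_ne_empty {T U : PTree d} (hT : T ≠ empty) (hU : U ≠ empty) :
    T.blowup U ≠ empty := by
  cases T <;> simp_all [blowup]

theorem isDAry_blowup {T U : PTree d} (hT : T.IsDAry) (hU : U.IsDAry) (hU0 : U ≠ empty) :
    (T.blowup U).IsDAry := by
  induction T with
  | empty => trivial
  | leaf => exact hU
  | node c ih =>
    obtain ⟨⟨i, j, hij, hi, hj⟩, h⟩ := hT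
    exact ⟨⟨i, j, hij, blowup_ne_empty hi hU0, blowup_ne_empty hj hU0⟩, fun i => ih i (h i)⟩

/-- Every copy of `D` in `T` yields `‖U‖ ^ ‖D‖` copies in the blow-up. -/
theorem pow_mul_copies_le_copies_blowup {D : PTree d} (hD : D.IsDAry) (T U : PTree d) :
    U.numLeaves ^ D.numLeaves * copies D T ≤ copies D (T.blowup U) := by
  -- `D` must vary, because the recursion at the root passes to its branches.
  induction T generalizing D with
  | empty =>
    cases D with
    | empty => simp [copies_empty, numLeaves]
    | leaf => simp [copies_leaf, numLeaves, blowup]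
    | node c =>
      rw [copies_eq_zero_of_lt (by have := two_le_numLeaves_node hD; simp only [numLeaves] at *; omega)]
      simp
  | leaf =>
    cases D with
    | empty => simp [copies_empty, numLeaves]
    | leaf => simp [copies_leaf, numLeaves, blowup]
    | node c =>
      rw [copies_eq_zero_of_lt (by have := two_le_numLeaves_node hD; simp only [numLeaves] at *; omega)]
      simp
  | node t ih =>
    cases D with
    | empty => simp [copies_empty, numLeaves]
    | leaf => simp [copies_leaf, numLeaves_blowup, numLeaves, mul_comm]
    | node c =>
      rw [blowup, copies_node_node hD, copies_node_node hD, mul_add, Finset.mul_sum,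
        Finset.mul_sum]
      refine add_le_add (Finset.sum_le_sum fun i _ => ih i hD) (Finset.sum_le_sum fun π _ => ?_)
      -- The factor `‖U‖ ^ ‖D‖` is shared out among the slots according to the sizes of the branches
      -- of `D`.
      rw [← numLeaves_perm c π, ← Finset.prod_pow_eq_pow_sum, ← Finset.prod_mul_distrib]
      exact Finset.prod_le_prod' fun j _ => ih j (hD.2 _)

/-! ### Shape of the even trees -/

/-- The index of the `i`-th branch of `H d (m + 1)`. -/
def evenPart (d m : ℕ) (i : Fin d) : ℕ := if (i : ℕ) < d - m % d then m / d else m / d + 1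

theorem H_succ (d m : ℕ) : H d (m + 1) = node fun i => H d (evenPart d m i) := by
  rw [H]
  congr 1
  ext i
  unfold evenPart
  split_ifs <;> rfl

theorem sum_evenPart {d : ℕ} (hd : 0 < d) (m : ℕ) : ∑ i, evenPart d m i = m := by
  have hb := Nat.mod_lt m hd
  have h : ∀ i : Fin d, evenPart d m i = m / d + if (i : ℕ) < d - m % d then 0 else 1 := by
    intro i; unfold evenPart; split_ifs <;> rfl
  have hs : ∑ i : Fin d, (if (i : ℕ) < d - m % d then 0 else 1) = m % d := by
    rw [Fin.sum_univ_eq_sum_range (fun i => if i < d - m % d then 0 else 1) d]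
    obtain ⟨a, ha⟩ : ∃ a, d = a + m % d := ⟨d - m % d, by omega⟩
    generalize m % d = b at *
    subst ha
    rw [Finset.sum_range_add, Finset.sum_eq_zero (by intro x hx; simp at hx; simp [hx])]
    simp
  simp only [h, Finset.sum_add_distrib, hs, Finset.sum_const, Finset.card_univ, Fintype.card_fin,
    smul_eq_mul, Nat.div_add_mod]

theorem evenPart_le {d : ℕ} (hd : 0 < d) (m : ℕ) (i : Fin d) : evenPart d m i ≤ m :=
  (Finset.single_le_sum (fun _ _ => Nat.zero_le _) (Finset.mem_univ i)).trans_eq (sum_evenPart hd m)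

/-- The index `n` counts the internal vertices, each of which replaces one leaf by `d` leaves. -/
theorem numLeaves_H {d : ℕ} (hd : 0 < d) (n : ℕ) : (H d n).numLeaves = (d - 1) * n + 1 := by
  induction n using Nat.strong_induction_on with
  | _ n ih =>
    cases n with
    | zero => simp [H, numLeaves]
    | succ m =>
      rw [H_succ, numLeaves]
      simp only [fun i => ih _ (Nat.lt_succ_of_le (evenPart_le hd m i))]
      rw [Finset.sum_add_distrib, ← Finset.mul_sum, sum_evenPart hd]
      simp only [Finset.sum_const, Finset.card_univ, Fintype.card_fin, smul_eq_mul]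
      obtain ⟨e, rfl⟩ : ∃ e, d = e + 1 := ⟨d - 1, by omega⟩
      simp; ring

theorem H_ne_empty {d : ℕ} (n : ℕ) : H d n ≠ empty := by
  cases n with
  | zero => simp [H]
  | succ m => simp [H_succ]

theorem isDAry_H {d : ℕ} (hd : 2 ≤ d) (n : ℕ) : (H d n).IsDAry := by
  induction n using Nat.strong_induction_on with
  | _ n ih =>
    cases n with
    | zero => rw [H]; trivial
    | succ m =>
      rw [H_succ]
      exact ⟨⟨⟨0, by omega⟩, ⟨1, by omega⟩, by simp, H_ne_empty _, H_ne_empty _⟩,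
        fun i => ih _ (Nat.lt_succ_of_le (evenPart_le (by omega) m i))⟩

theorem tendsto_numLeaves_H {d : ℕ} (hd : 2 ≤ d) :
    Tendsto (fun n => (H d n).numLeaves) atTop atTop := by
  refine tendsto_atTop_mono (fun n => ?_) tendsto_id
  rw [numLeaves_H (by omega)]
  have : 1 * n ≤ (d - 1) * n := Nat.mul_le_mul_right _ (by omega)
  simp only [id]; omega

theorem tendsto_evenPart {d : ℕ} (hd : 0 < d) (i : Fin d) :
    Tendsto (fun m => evenPart d m i) atTop atTop := by
  refine tendsto_atTop_mono (fun m => ?_) (Nat.tendsto_div_const_atTop hd.ne')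
  unfold evenPart
  split_ifs <;> omega

/-- The proportion of the leaves of `H d (m + 1)` that lie in the `i`-th branch. -/
noncomputable def leafRatio (d m : ℕ) (i : Fin d) : ℝ :=
  ((H d (evenPart d m i)).numLeaves : ℝ) / ((H d (m + 1)).numLeaves : ℝ)

theorem tendsto_leafRatio {d : ℕ} (hd : 2 ≤ d) (i : Fin d) :
    Tendsto (fun m => leafRatio d m i) atTop (𝓝 (1 / (d : ℝ))) := by
  rw [tendsto_iff_dist_tendsto_zero]
  refine squeeze_zero (fun _ => dist_nonneg) (fun m => ?_)
    (tendsto_one_div_add_atTop_nhds_zero_nat (𝕜 := ℝ))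
  obtain ⟨e, rfl⟩ : ∃ e, d = e + 1 := ⟨d - 1, by omega⟩
  have he : (1 : ℝ) ≤ e := by exact_mod_cast (by omega : 1 ≤ e)
  have hm : (0 : ℝ) ≤ m := m.cast_nonneg
  have hdm := Nat.div_add_mod m (e + 1)
  have hb := Nat.mod_lt m (by omega : 0 < e + 1)
  -- Rounding changes `m / d` by at most one, where `d = e + 1`.
  have hs : |((e : ℝ) + 1) * (evenPart (e + 1) m i : ℝ) - m| ≤ e + 1 := by
    have h1 : (e + 1) * evenPart (e + 1) m i ≤ m + (e + 1) := by
      unfold evenPart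
      split_ifs
      · omega
      · rw [Nat.mul_add]; omega
    have h2 : m ≤ (e + 1) * evenPart (e + 1) m i + (e + 1) := by
      unfold evenPart
      split_ifs
      · omega
      · rw [Nat.mul_add]; omega
    have h1' : ((e : ℝ) + 1) * (evenPart (e + 1) m i : ℝ) ≤ m + (e + 1) := by exact_mod_cast h1
    have h2' : (m : ℝ) ≤ ((e : ℝ) + 1) * (evenPart (e + 1) m i : ℝ) + (e + 1) := by
      exact_mod_cast h2
    rw [abs_le]
    constructor <;> linarith
  rw [Real.dist_eq, leafRatio, numLeaves_H (by omega), numLeaves_H (by omega)]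
  simp only [Nat.add_sub_cancel]
  push_cast
  have hN : (0 : ℝ) < e * (m + 1) + 1 := by positivity
  have key : ((e : ℝ) * (evenPart (e + 1) m i : ℝ) + 1) / (e * (m + 1) + 1) - 1 / (e + 1) =
      e * ((e + 1) * (evenPart (e + 1) m i : ℝ) - m) / ((e * (m + 1) + 1) * (e + 1)) := by
    field_simp
    ring
  rw [key, abs_div, abs_mul, abs_of_pos (by positivity : (0 : ℝ) < (e * (m + 1) + 1) * (e + 1)),
    abs_of_nonneg (by positivity : (0 : ℝ) ≤ e), div_le_div_iff₀ (by positivity) (by positivity)]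
  have h3 : (e : ℝ) * |((e : ℝ) + 1) * (evenPart (e + 1) m i : ℝ) - m| * (m + 1) ≤
      e * (e + 1) * (m + 1) := by gcongr
  nlinarith

/-! ### Asymptotic number of copies in the even trees -/

/-- The limit of `c(D, H_n) / ‖H_n‖ ^ ‖D‖`. -/
noncomputable def evenCoeff : PTree d → ℝ
  | empty => 1
  | leaf => 1
  | node c => ((node c).M.card : ℝ) / ((d : ℝ) ^ (node c).numLeaves - d) * ∏ j, evenCoeff (c j)

theorem pow_sub_pos {d : ℕ} (hd : 2 ≤ d) {k : ℕ} (hk : 2 ≤ k) : 0 < (d : ℝ) ^ k - d := by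
  have h : (1 : ℝ) < d := by exact_mod_cast hd
  rw [sub_pos]
  calc (d : ℝ) = d ^ 1 := (pow_one _).symm
    _ < d ^ k := pow_lt_pow_right₀ h hk

theorem evenCoeff_nonneg (hd : 2 ≤ d) {D : PTree d} (hD : D.IsDAry) : 0 ≤ evenCoeff D := by
  induction D with
  | empty => exact zero_le_one
  | leaf => exact zero_le_one
  | node c ih =>
    rw [evenCoeff]
    exact mul_nonneg (div_nonneg (Nat.cast_nonneg _)
      (pow_sub_pos hd (two_le_numLeaves_node hD)).le)
      (Finset.prod_nonneg fun j _ => ih j (hD.2 j))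

theorem copies_le_pow (D T : PTree d) : copies D T ≤ T.numLeaves ^ D.numLeaves :=
  (copies_le_choose D T).trans (Nat.choose_le_pow _ _)

theorem numLeaves_H_pos (hd : 0 < d) (n : ℕ) : 0 < ((H d n).numLeaves : ℝ) := by
  rw [numLeaves_H hd]; positivity

theorem numLeaves_evenPart (hd : 0 < d) (m : ℕ) (i : Fin d) :
    ((H d (evenPart d m i)).numLeaves : ℝ) = leafRatio d m i * (H d (m + 1)).numLeaves := by
  rw [leafRatio, div_mul_cancel₀ _ (numLeaves_H_pos hd _).ne']

/-- In the normalized recursion the leaf proportions tend to `1 / d`, and the term `G` from the root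
converges by induction on `D`. The limit must solve `L = d * d ^ (-k) * L + lim G`, and `evenCoeff
D` is the solution. -/
theorem tendsto_copies_H (hd : 2 ≤ d) {D : PTree d} (hD : D.IsDAry) :
    Tendsto (fun n => (copies D (H d n) : ℝ) / ((H d n).numLeaves : ℝ) ^ D.numLeaves) atTop
      (𝓝 (evenCoeff D)) := by
  have hd0 : 0 < d := by omega
  have hdr : (0 : ℝ) < d := by exact_mod_cast hd0
  induction D with
  | empty =>
    simp [copies_empty, numLeaves, evenCoeff]
  | leaf =>
    simp [copies_leaf, numLeaves, evenCoeff, div_self (numLeaves_H_pos hd0 _).ne']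
  | node c ih =>
    set D := node c with hDdef
    set k := D.numLeaves with hk
    have hk2 : 2 ≤ k := two_le_numLeaves_node hD
    set L := evenCoeff D with hL
    set u : PTree d → ℕ → ℝ := fun E n =>
      (copies E (H d n) : ℝ) / ((H d n).numLeaves : ℝ) ^ E.numLeaves with hu
    have hcu : ∀ E n, (copies E (H d n) : ℝ) = u E n * ((H d n).numLeaves : ℝ) ^ E.numLeaves :=
      fun E n => (div_mul_cancel₀ _ (pow_pos (numLeaves_H_pos hd0 n) _).ne').symm
    set G : ℕ → ℝ := fun m => ∑ π ∈ D.M, ∏ j, (leafRatio d m j ^ (c (π j)).numLeaves *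
      u (c (π j)) (evenPart d m j)) with hG
    have hrec : ∀ m, u D (m + 1) = ∑ i, leafRatio d m i ^ k * u D (evenPart d m i) + G m := by
      intro m
      have hN := pow_pos (numLeaves_H_pos hd0 (m + 1)) k
      have hN' := numLeaves_H_pos hd0 (m + 1)
      have h1 : ∀ i, (copies D (H d (evenPart d m i)) : ℝ) =
          leafRatio d m i ^ k * u D (evenPart d m i) * ((H d (m + 1)).numLeaves : ℝ) ^ k := by
        intro i
        rw [hcu, numLeaves_evenPart hd0, mul_pow]; ring
      have h2 : ∀ π : Equiv.Perm (Fin d),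
          ∏ j, (copies (c (π j)) (H d (evenPart d m j)) : ℝ) =
          (∏ j, (leafRatio d m j ^ (c (π j)).numLeaves * u (c (π j)) (evenPart d m j))) *
            ((H d (m + 1)).numLeaves : ℝ) ^ k := by
        intro π
        rw [hk, hDdef, ← numLeaves_perm c π, ← Finset.prod_pow_eq_pow_sum,
          ← Finset.prod_mul_distrib]
        refine Finset.prod_congr rfl fun j _ => ?_
        rw [hcu, numLeaves_evenPart hd0, mul_pow]; ring
      have h3 : (copies D (H d (m + 1)) : ℝ) = (∑ i, leafRatio d m i ^ k * u D (evenPart d m i) +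
          G m) * ((H d (m + 1)).numLeaves : ℝ) ^ k := by
        have h4 : copies D (H d (m + 1)) = ∑ i, copies D (H d (evenPart d m i)) +
            ∑ π ∈ D.M, ∏ j, copies (c (π j)) (H d (evenPart d m j)) := by
          rw [H_succ]
          exact copies_node_node hD _
        rw [h4]
        push_cast
        rw [add_mul, Finset.sum_mul, hG, Finset.sum_mul]
        simp only [h1, h2]
      show (copies D (H d (m + 1)) : ℝ) / ((H d (m + 1)).numLeaves : ℝ) ^ k = _
      rw [h3, mul_div_cancel_right₀ _ hN.ne']
    have hratio := tendsto_leafRatio hd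
    have hGlim : Tendsto G atTop (𝓝 (∑ π ∈ D.M, ∏ j, ((1 / (d : ℝ)) ^ (c (π j)).numLeaves *
        evenCoeff (c (π j))))) :=
      tendsto_finsetSum _ fun π _ => tendsto_finsetProd _ fun j _ =>
        ((hratio j).pow _).mul ((ih (π j) (hD.2 _)).comp (tendsto_evenPart hd0 j))
    have hGval : ∑ π ∈ D.M, ∏ j, ((1 / (d : ℝ)) ^ (c (π j)).numLeaves * evenCoeff (c (π j))) =
        D.M.card * ((1 / (d : ℝ)) ^ k * ∏ j, evenCoeff (c j)) := by
      rw [← nsmul_eq_mul, ← Finset.sum_const]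
      refine Finset.sum_congr rfl fun π _ => ?_
      rw [Finset.prod_mul_distrib, Finset.prod_pow_eq_pow_sum, numLeaves_perm,
        Equiv.prod_comp π fun j => evenCoeff (c j)]
    have hsum : Tendsto (fun m => ∑ i, leafRatio d m i ^ k) atTop (𝓝 (d * (1 / (d : ℝ)) ^ k)) := by
      have := tendsto_finsetSum (Finset.univ : Finset (Fin d)) fun i _ => (hratio i).pow k
      simpa using this
    have hpos := pow_sub_pos hd hk2
    -- The error left after subtracting `L` from both sides of the recursion; it vanishes in the
    -- limit by the fixed-point equation.
    have hδ : Tendsto (fun m => G m + (∑ i, leafRatio d m i ^ k - 1) * L) atTop (𝓝 0) := by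
      have := hGlim.add ((hsum.sub_const 1).mul_const L)
      convert this using 2
      rw [hGval, hL, hDdef, evenCoeff, ← hDdef, ← hk, one_div, inv_pow]
      field_simp
      ring
    have habs : ∀ m i, |leafRatio d m i ^ k| = leafRatio d m i ^ k := fun m i =>
      abs_of_nonneg (by unfold leafRatio; positivity)
    have hv : Tendsto (fun n => u D n - L) atTop (𝓝 0) := by
      refine tendsto_zero_of_contraction (y := fun i m => leafRatio d m i ^ k)
        (s := fun i m => evenPart d m i) (C := 1 + |L|) (fun n => ?_) (fun m => ?_) hδ
        (tendsto_evenPart hd0) (by simpa only [habs] using hsum) ?_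
      · have h0 : 0 ≤ u D n := by simp only [hu]; positivity
        have h1 : u D n ≤ 1 := div_le_one_of_le₀ (by exact_mod_cast copies_le_pow D (H d n))
          (by positivity)
        refine (abs_sub _ _).trans (add_le_add_left ?_ _)
        rwa [abs_of_nonneg h0]
      · rw [hrec]
        simp only [mul_sub, Finset.sum_sub_distrib, ← Finset.sum_mul]
        ring
      · have : (d : ℝ) * (1 / (d : ℝ)) ^ k = d / d ^ k := by rw [one_div, inv_pow]; rfl
        rw [this, div_lt_one (by positivity)]
        linarith
    simpa using hv.add_const L

theorem tendsto_density_H (hd : 2 ≤ d) {D : PTree d} (hD : D.IsDAry) :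
    Tendsto (fun n => density D (H d n)) atTop (𝓝 (evenCoeff D * D.numLeaves.factorial)) := by
  refine ((tendsto_copies_H hd hD).mul
    ((tendsto_pow_div_choose D.numLeaves).comp (tendsto_numLeaves_H hd))).congr fun n => ?_
  have := (pow_pos (numLeaves_H_pos (by omega : 0 < d) n) D.numLeaves).ne'
  simp only [Function.comp, density]
  field_simp

theorem eta_eq (hd : 2 ≤ d) {D : PTree d} (hD : D.IsDAry) :
    eta D = evenCoeff D * D.numLeaves.factorial :=
  (tendsto_density_H hd hD).limUnder_eq

/-! ### From asymptotic densities to bounds for every tree, and back -/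

/-- The filter of `d`-ary trees with a growing number of leaves. -/
abbrev manyLeaves (d : ℕ) : Filter {T : PTree d // T.IsDAry} :=
  comap (fun T : {T : PTree d // T.IsDAry} => T.1.numLeaves) atTop

theorem tendsto_H_manyLeaves (hd : 2 ≤ d) :
    Tendsto (fun n => (⟨H d n, isDAry_H hd n⟩ : {T : PTree d // T.IsDAry})) atTop
      (manyLeaves d) :=
  tendsto_comap_iff.2 (tendsto_numLeaves_H hd)

theorem isBoundedUnder_density (D : PTree d) :
    IsBoundedUnder (· ≤ ·) (manyLeaves d) fun T => density D T.1 :=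
  isBoundedUnder_of ⟨1, fun T => density_le_one D T.1⟩

/-- A single tree with too many copies would, blown up by ever larger trees, give arbitrarily large
trees whose density exceeds the limit superior. Blowing up scales the count by at least `‖U‖ ^ ‖D‖`,
so no lower-order error remains. -/
theorem copies_le_inducibility_mul (hd : 2 ≤ d) {D T : PTree d} (hD : D.IsDAry) (hT : T.IsDAry)
    (hT0 : T ≠ empty) :
    (copies D T : ℝ) ≤ inducibility D / D.numLeaves.factorial * (T.numLeaves : ℝ) ^ D.numLeaves := by
  set k := D.numLeaves
  have hn : 0 < T.numLeaves := Nat.pos_of_ne_zero ((numLeaves_eq_zero_iff hT).not.2 hT0)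
  have key : ∀ a, inducibility D < a →
      (copies D T : ℝ) ≤ a / k.factorial * (T.numLeaves : ℝ) ^ k := by
    intro a ha
    have hev : ∀ᶠ U in manyLeaves d, density D U.1 < a :=
      eventually_lt_of_limsup_lt ha (isBoundedUnder_density D)
    have hbl : Tendsto (fun m => (⟨T.blowup (H d m), isDAry_blowup hT (isDAry_H hd m)
        (H_ne_empty m)⟩ : {T : PTree d // T.IsDAry})) atTop (manyLeaves d) := by
      refine tendsto_comap_iff.2 ?_
      refine tendsto_atTop_mono (fun m => ?_) (tendsto_numLeaves_H hd)
      simp only [Function.comp, numLeaves_blowup]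
      exact Nat.le_mul_of_pos_left _ hn
    obtain ⟨m, hm⟩ := (hbl.eventually hev).exists
    have ha0 : 0 ≤ a := (density_nonneg _ _).trans hm.le
    have hN := numLeaves_H_pos (by omega : 0 < d) m
    have h1 : ((H d m).numLeaves : ℝ) ^ k * copies D T ≤ copies D (T.blowup (H d m)) := by
      exact_mod_cast pow_mul_copies_le_copies_blowup hD T (H d m)
    have h2 : (copies D (T.blowup (H d m)) : ℝ) ≤
        a * (((T.numLeaves : ℝ) * (H d m).numLeaves) ^ k / k.factorial) := by
      rw [copies_eq_density_mul]
      refine mul_le_mul hm.le ?_ (Nat.cast_nonneg _) ha0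
      rw [numLeaves_blowup, ← Nat.cast_mul]
      -- The inequality `N.choose k ≤ N ^ k / k!` holds for every `N`, so a single blow-up of
      -- density below `a` suffices.
      exact Nat.choose_le_pow_div _ _
    refine le_of_mul_le_mul_left ((h1.trans h2).trans_eq ?_) (pow_pos hN k)
    rw [mul_pow]; ring
  have hlim : Tendsto (fun a : ℝ => a / k.factorial * (T.numLeaves : ℝ) ^ k)
      (𝓝[>] inducibility D) (𝓝 (inducibility D / k.factorial * (T.numLeaves : ℝ) ^ k)) :=
    ((continuous_id.div_const _).mul_const _).continuousWithinAt
  exact ge_of_tendsto hlim (eventually_mem_nhdsWithin.mono fun a ha => key a ha)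

/-- Dividing the uniform bound by the binomial coefficient gives `≤`, since `N ^ k / N.choose k`
tends to `k!`. The even trees are among the competitors, which gives `≥`. -/
theorem inducibility_eq_eta (hd : 2 ≤ d) {D : PTree d} (hD : D.IsDAry)
    (h : ∀ T : PTree d, T.IsDAry →
      (copies D T : ℝ) ≤ evenCoeff D * (T.numLeaves : ℝ) ^ D.numLeaves) :
    inducibility D = eta D := by
  -- The even trees show that arbitrarily large `d`-ary trees exist.
  have : NeBot (manyLeaves d) := (tendsto_H_manyLeaves hd).neBot
  rw [eta_eq hd hD]
  apply le_antisymm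
  · have hlim : Tendsto (fun T : {T : PTree d // T.IsDAry} => evenCoeff D *
        ((T.1.numLeaves : ℝ) ^ D.numLeaves / (T.1.numLeaves.choose D.numLeaves : ℝ)))
        (manyLeaves d) (𝓝 (evenCoeff D * D.numLeaves.factorial)) :=
      ((tendsto_pow_div_choose D.numLeaves).comp tendsto_comap).const_mul _
    rw [← hlim.limsup_eq]
    refine limsup_le_limsup (Eventually.of_forall fun T => ?_) ?_ hlim.isBoundedUnder_le
    · simp only [density, ← mul_div_assoc]
      exact div_le_div_of_nonneg_right (h T.1 T.2) (Nat.cast_nonneg _)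
    · exact (isBoundedUnder_of ⟨0, fun T => density_nonneg D T.1⟩ :
        IsBoundedUnder (· ≥ ·) (manyLeaves d) fun T => density D T.1).isCoboundedUnder_le
  · refine le_of_forall_gt_imp_ge_of_dense fun a ha => ?_
    have hev : ∀ᶠ U in manyLeaves d, density D U.1 < a :=
      eventually_lt_of_limsup_lt ha (isBoundedUnder_density D)
    exact le_of_tendsto (tendsto_density_H hd hD)
      (((tendsto_H_manyLeaves hd).eventually hev).mono fun n hn => hn.le)

theorem copies_empty_le (T : PTree d) :
    (copies empty T : ℝ) ≤ evenCoeff (empty : PTree d) *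
      (T.numLeaves : ℝ) ^ (empty : PTree d).numLeaves := by
  simp [copies_empty, evenCoeff, numLeaves]

theorem copies_leaf_le (T : PTree d) :
    (copies leaf T : ℝ) ≤ evenCoeff (leaf : PTree d) *
      (T.numLeaves : ℝ) ^ (leaf : PTree d).numLeaves := by
  simp [copies_leaf, evenCoeff, numLeaves]

theorem copies_le_evenCoeff_of_inducibility_eq_eta (hd : 2 ≤ d) {D T : PTree d} (hD : D.IsDAry)
    (hT : T.IsDAry) (h : inducibility D = eta D) :
    (copies D T : ℝ) ≤ evenCoeff D * (T.numLeaves : ℝ) ^ D.numLeaves := by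
  by_cases hT0 : T = empty
  · subst hT0
    by_cases hD0 : D = empty
    · subst hD0
      exact copies_empty_le _
    · have := Nat.pos_of_ne_zero ((numLeaves_eq_zero_iff hD).not.2 hD0)
      rw [copies_eq_zero_of_lt (by simpa only [numLeaves] using this), Nat.cast_zero]
      exact mul_nonneg (evenCoeff_nonneg hd hD) (by positivity)
  · have := copies_le_inducibility_mul hd hD hT hT0
    rwa [h, eta_eq hd hD, mul_div_cancel_right₀ _ (by positivity)] at this

/-! ### The function `Z` and the sharp upper bound -/

theorem Z_const (hd : 2 ≤ d) (D : PTree d) :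
    D.Z (fun _ => 1 / (d : ℝ)) = (D.M.card : ℝ) / ((d : ℝ) ^ D.numLeaves - d) := by
  have hdr : (2 : ℝ) ≤ d := by exact_mod_cast hd
  unfold Z
  cases D with
  | empty => simp [branch, numLeaves, mul_comm, div_eq_mul_inv]
  -- Both denominators vanish here, so both sides are `0` by the convention for division by zero.
  | leaf => simp [numLeaves, (by positivity : (d : ℝ) ≠ 0)]
  | node c =>
    have h : ∀ π : Equiv.Perm (Fin d), ∏ j, (1 / (d : ℝ)) ^ ((node c).branch (π j)).numLeaves =
        (1 / (d : ℝ)) ^ (node c).numLeaves := fun π => by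
      rw [Finset.prod_pow_eq_pow_sum, ← numLeaves_perm c π]; rfl
    simp only [h, Finset.sum_const, Finset.card_univ, Fintype.card_fin, nsmul_eq_mul]
    generalize (node c).numLeaves = k
    have hd0 : (d : ℝ) ≠ 0 := by positivity
    have : 1 - (d : ℝ) * (1 / d) ^ k = (d ^ k - d) * (1 / d) ^ k := by
      rw [sub_mul, ← mul_pow, mul_one_div_cancel hd0, one_pow]
    rw [this]
    have : ((1 : ℝ) / d) ^ k ≠ 0 := by positivity
    rw [one_div_mul_eq_div, mul_div_mul_right _ _ this]

/-- The bound on the copies whose root is the root of `node t`, in terms of the maximum of `Z`. -/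
theorem sum_prod_pow_le {c t : Fin d → PTree d} {a : ℝ} (hc : (node c).IsDAry)
    (ht : (node t).IsDAry) (ha : ∀ x ∈ simplexDomain d, (node c).Z x ≤ a) :
    ∑ π ∈ (node c).M, ∏ j, ((t j).numLeaves : ℝ) ^ (c (π j)).numLeaves ≤
      a * (((node t).numLeaves : ℝ) ^ (node c).numLeaves -
        ∑ j, ((t j).numLeaves : ℝ) ^ (node c).numLeaves) := by
  set n : ℝ := ((node t).numLeaves : ℝ) with hn
  set k := (node c).numLeaves with hk
  have hk2 : 2 ≤ k := two_le_numLeaves_node hc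
  have hsum : ∑ j, ((t j).numLeaves : ℝ) = n := by rw [hn, numLeaves]; push_cast; rfl
  have hn0 : 0 < n := by
    have := two_le_numLeaves_node ht
    rw [hn]; exact_mod_cast (by omega : 0 < (node t).numLeaves)
  set x : Fin d → ℝ := fun j => (t j).numLeaves / n with hx
  have htx : ∀ j, ((t j).numLeaves : ℝ) = n * x j := fun j => (mul_div_cancel₀ _ hn0.ne').symm
  have hx1 : ∑ j, x j = 1 := by rw [hx, ← Finset.sum_div, hsum, div_self hn0.ne']
  have hx0 : ∀ j, 0 ≤ x j := fun j => by positivity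
  have hxlt : ∀ j, x j < 1 := by
    intro j
    -- The root has two nonempty branches, so some branch other than `j` takes a positive share of
    -- the leaves.
    obtain ⟨⟨p, q, hpq, hp, hq⟩, ht'⟩ := ht
    obtain ⟨l, hlj, hl⟩ : ∃ l, l ≠ j ∧ t l ≠ empty := by
      by_cases h : p = j
      · exact ⟨q, fun h' => hpq (h.trans h'.symm), hq⟩
      · exact ⟨p, h, hp⟩
    have hl0 : 0 < x l := div_pos (by
      exact_mod_cast Nat.pos_of_ne_zero ((numLeaves_eq_zero_iff (ht' l)).not.2 hl)) hn0
    have : x l + x j ≤ ∑ i, x i := by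
      rw [← Finset.sum_pair hlj]
      exact Finset.sum_le_sum_of_subset_of_nonneg (Finset.subset_univ _) fun i _ _ => hx0 i
    linarith
  -- The denominator of `Z` is positive, so the bound on `Z` can be multiplied out.
  have hpow : ∑ j, x j ^ k < 1 := by
    rw [← hx1]
    refine Finset.sum_lt_sum (fun j _ => pow_le_of_le_one (hx0 j) (hxlt j).le (by omega)) ?_
    obtain ⟨j, -, hj⟩ := Finset.exists_ne_zero_of_sum_ne_zero (hx1.trans_ne one_ne_zero)
    refine ⟨j, Finset.mem_univ j, ?_⟩
    calc x j ^ k < x j ^ 1 := pow_lt_pow_right_of_lt_one₀ ((hx0 j).lt_of_ne' hj) (hxlt j) hk2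
      _ = x j := pow_one _
  have hZ := ha x ⟨fun j => ⟨hx0 j, hxlt j⟩, hx1⟩
  rw [Z, one_div_mul_eq_div, div_le_iff₀ (sub_pos.2 hpow)] at hZ
  have h1 : ∀ π : Equiv.Perm (Fin d), ∏ j, ((t j).numLeaves : ℝ) ^ (c (π j)).numLeaves =
      n ^ k * ∏ j, x j ^ (c (π j)).numLeaves := by
    intro π
    simp only [htx, mul_pow, Finset.prod_mul_distrib]
    rw [Finset.prod_pow_eq_pow_sum, numLeaves_perm]
  have h2 : n ^ k - ∑ j, ((t j).numLeaves : ℝ) ^ k = n ^ k * (1 - ∑ j, x j ^ k) := by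
    simp only [htx, mul_pow, ← Finset.mul_sum]
    ring
  rw [h2]
  simp only [h1, ← Finset.mul_sum]
  calc _ ≤ n ^ k * (a * (1 - ∑ j, x j ^ k)) := mul_le_mul_of_nonneg_left hZ (by positivity)
    _ = _ := by ring

/-- Copies inside one branch of `T` are bounded by induction, and copies meeting at the root by the
exact bounds for the `c i` together with `sum_prod_pow_le`. -/
theorem copies_node_le (hd : 2 ≤ d) {c : Fin d → PTree d} (hc : (node c).IsDAry)
    (hbranch : ∀ i, inducibility (c i) = eta (c i))
    (hZ : ∀ x ∈ simplexDomain d, (node c).Z x ≤ (node c).Z fun _ => 1 / (d : ℝ))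
    {T : PTree d} (hT : T.IsDAry) :
    (copies (node c) T : ℝ) ≤ evenCoeff (node c) * (T.numLeaves : ℝ) ^ (node c).numLeaves := by
  have hk := two_le_numLeaves_node hc
  have h0 := evenCoeff_nonneg hd hc
  induction T with
  | empty =>
    rw [copies_eq_zero_of_lt (by simp only [numLeaves] at *; omega), Nat.cast_zero]
    positivity
  | leaf =>
    rw [copies_eq_zero_of_lt (by simp only [numLeaves] at *; omega), Nat.cast_zero]
    positivity
  | node t ih =>
    set P := ∏ j, evenCoeff (c j) with hP
    have hP0 : 0 ≤ P := Finset.prod_nonneg fun j _ => evenCoeff_nonneg hd (hc.2 j)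
    -- With this factorization the terms `∑ ‖t j‖ ^ k` from the two kinds of copies cancel, leaving
    -- exactly `evenCoeff (node c) * ‖T‖ ^ k`.
    have hcoeff : evenCoeff (node c) = (node c).Z (fun _ => 1 / (d : ℝ)) * P := by
      rw [Z_const hd, evenCoeff]
    have h1 : ∀ π : Equiv.Perm (Fin d), ∏ j, (copies (c (π j)) (t j) : ℝ) ≤
        P * ∏ j, ((t j).numLeaves : ℝ) ^ (c (π j)).numLeaves := by
      intro π
      rw [hP, ← Equiv.prod_comp π fun j => evenCoeff (c j), ← Finset.prod_mul_distrib]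
      exact Finset.prod_le_prod (fun _ _ => Nat.cast_nonneg _) fun j _ =>
        copies_le_evenCoeff_of_inducibility_eq_eta hd (hc.2 _) (hT.2 j) (hbranch _)
    rw [copies_node_node hc]
    push_cast
    calc _ ≤ ∑ i, evenCoeff (node c) * ((t i).numLeaves : ℝ) ^ (node c).numLeaves +
          ∑ π ∈ (node c).M, P * ∏ j, ((t j).numLeaves : ℝ) ^ (c (π j)).numLeaves :=
        add_le_add (Finset.sum_le_sum fun i _ => ih i (hT.2 i))
          (Finset.sum_le_sum fun π _ => h1 π)
      _ ≤ evenCoeff (node c) * ∑ i, ((t i).numLeaves : ℝ) ^ (node c).numLeaves +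
          P * ((node c).Z (fun _ => 1 / (d : ℝ)) *
            ((node t).numLeaves ^ (node c).numLeaves -
              ∑ j, ((t j).numLeaves : ℝ) ^ (node c).numLeaves)) := by
        rw [← Finset.mul_sum, ← Finset.mul_sum]
        exact add_le_add_right (mul_le_mul_of_nonneg_left (sum_prod_pow_le hc hT hZ) hP0) _
      _ = _ := by rw [hcoeff]; ring

end PTree

end Inducibility

theorem theorem5 (d : ℕ) (hd : 2 ≤ d) (D : Inducibility.PTree d) (hD : D.IsDAry)
    (hbranch : ∀ i : Fin d, (D.branch i).inducibility = (D.branch i).eta)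
    (hsup : IsLUB (D.Z '' Inducibility.simplexDomain d) (D.Z fun _ => 1 / (d : ℝ))) :
    D.Z (fun _ => 1 / (d : ℝ)) = (D.M.card : ℝ) / ((d : ℝ) ^ D.numLeaves - d) ∧
    Tendsto (fun n : ℕ => Inducibility.PTree.density D (Inducibility.PTree.H d n)) atTop
      (𝓝 D.eta) ∧
    D.inducibility = D.eta := by
  refine ⟨Inducibility.PTree.Z_const hd D, ?_,
    Inducibility.PTree.inducibility_eq_eta hd hD fun T hT => ?_⟩
  · rw [Inducibility.PTree.eta_eq hd hD]
    exact Inducibility.PTree.tendsto_density_H hd hD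
  · cases D with
    | empty => exact Inducibility.PTree.copies_empty_le T
    | leaf => exact Inducibility.PTree.copies_leaf_le T
    | node c =>
      exact Inducibility.PTree.copies_node_le hd hD hbranch
        (fun x hx => hsup.1 (Set.mem_image_of_mem _ hx)) hT
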